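/- Let $n\ge 1$, let $A,B$ be $n\times n$ complex (Hermitian) positive definite matrices, and let $a,b\ge 0$ be real numbers. Let $A\#B=A^{1/2}(A^{-1/2}BA^{-1/2})^{1/2}A^{1/2}$ denote the Kubo-Ando geometric mean, and let $(AB)^{1/2}$ and $(BA)^{1/2}$ denote the principal square roots of $AB$ and $BA$ (the unique square roots all of whose eigenvalues have positive real part). Put \[ H^{\#}_{a,b}(A,B)=a^2A+b^2B+2ab\,(A\#B),\qquad W_{a,b}(A,B)=a^2A+b^2B+ab\bigl((AB)^{1/2}+(BA)^{1/2}\bigr). \] Both matrices are Hermitian. For a Hermitian $n\times n$ matrix $T$ let $\lambda_1^\downarrow(T)\ge\cdots\ge\lambda_n^\downarrow(T)$ be its eigenvalues, counted with multiplicity, in decreasing order. Then \[ \lambda_n^\downarrow\bigl(H^{\#}_{a,b}(A,B)\bigr)\ge\lambda_n^\downarrow\bigl(W_{a,b}(A,B)\bigr), \qquad \lambda_1^\downarrow\bigl(H^{\#}_{a,b}(A,B)\bigr)\le\lambda_1^\downarrow\bigl(W_{a,b}(A,B)\bigr), \] \[ \operatorname{Tr}H^{\#}_{a,b}(A,B)\le\operatorname{Tr}W_{a,b}(A,B),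 \qquad \sum_{j=1}^{n-1}\lambda_j^\downarrow\bigl(H^{\#}_{a,b}(A,B)\bigr)\le\sum_{j=1}^{n-1}\lambda_j^\downarrow\bigl(W_{a,b}(A,B)\bigr). \] -/

import Mathlib

open scoped ComplexOrder MatrixOrder

namespace HeronMeans

noncomputable section

/-- `S` is a principal square root of the square complex matrix `M`: `S ^ 2 = M` and every
eigenvalue of `S` lies in the open right half-plane. -/
def IsPrincipalSqrt {n : ℕ} (S M : Matrix (Fin n) (Fin n) ℂ) : Prop :=
  S * S = M ∧ ∀ μ ∈ spectrum ℂ S, 0 < μ.re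

open Classical in
/-- The principal square root `M ^ (1/2)` of a square complex matrix (and `0` if there is none).
It is unique by `IsPrincipalSqrt.unique`, and it exists for a product of two positive definite
matrices by `isPrincipalSqrt_principalSqrt_mul`. -/
def principalSqrt {n : ℕ} (M : Matrix (Fin n) (Fin n) ℂ) : Matrix (Fin n) (Fin n) ℂ :=
  if h : ∃ S, IsPrincipalSqrt S M then h.choose else 0

/-- The Kubo-Ando geometric mean `A # B = A^{1/2} (A^{-1/2} B A^{-1/2})^{1/2} A^{1/2}` of positive
definite matrices; `CFC.sqrt` is the positive semidefinite square root. -/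
def geomMean {n : ℕ} (A B : Matrix (Fin n) (Fin n) ℂ) : Matrix (Fin n) (Fin n) ℂ :=
  CFC.sqrt A * CFC.sqrt ((CFC.sqrt A)⁻¹ * B * (CFC.sqrt A)⁻¹) * CFC.sqrt A

/-- The Kubo-Ando Heron expression `H^#_{a,b}(A,B) = a² A + b² B + 2ab (A # B)`. -/
def heron {n : ℕ} (a b : ℝ) (A B : Matrix (Fin n) (Fin n) ℂ) : Matrix (Fin n) (Fin n) ℂ :=
  a ^ 2 • A + b ^ 2 • B + (2 * a * b) • geomMean A B

/-- The weighted Bures-Wasserstein expression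
`W_{a,b}(A,B) = a² A + b² B + ab ((AB)^{1/2} + (BA)^{1/2})`. -/
def wasserstein {n : ℕ} (a b : ℝ) (A B : Matrix (Fin n) (Fin n) ℂ) :
    Matrix (Fin n) (Fin n) ℂ :=
  a ^ 2 • A + b ^ 2 • B + (a * b) • (principalSqrt (A * B) + principalSqrt (B * A))

/-- The eigenvalues `λ_1 ≥ ... ≥ λ_n` of a Hermitian matrix, with multiplicity and in decreasing
order; `eigDesc T hT j` is the `(j + 1)`-st largest one. -/
def eigDesc {n : ℕ} (T : Matrix (Fin n) (Fin n) ℂ) (hT : T.IsHermitian) (j : Fin n) : ℝ :=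
  hT.eigenvalues₀ (Fin.cast (Fintype.card_fin n).symm j)

theorem IsPrincipalSqrt.unique {n : ℕ} {S T M : Matrix (Fin n) (Fin n) ℂ}
    (hS : IsPrincipalSqrt S M) (hT : IsPrincipalSqrt T M) : S = T := by
  rcases Nat.eq_zero_or_pos n with rfl | hn
  · exact Subsingleton.elim _ _
  have : Nonempty (Fin n) := ⟨⟨0, hn⟩⟩
  have hD : S * (S - T) = (S - T) * (-T) := by
    have h := hS.1.trans hT.1.symm
    rw [mul_sub, h]
    noncomm_ring
  have key : ∀ p : Polynomial ℂ,
      Polynomial.aeval S p * (S - T) = (S - T) * Polynomial.aeval (-T) p := by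
    intro p
    have hX : SemiconjBy (S - T) (-T) S := hD.symm
    induction p using Polynomial.induction_on' with
    | add p q hp hq => rw [map_add, map_add, add_mul, mul_add, hp, hq]
    | monomial k c =>
      rw [Polynomial.aeval_monomial, Polynomial.aeval_monomial, mul_assoc,
        ← (hX.pow_right k).eq, ← mul_assoc, ← mul_assoc, Algebra.commutes]
  have h0 := key (-T).charpoly
  rw [Matrix.aeval_self_charpoly, mul_zero] at h0
  have hu : IsUnit (Polynomial.aeval S (-T).charpoly) := by
    rw [← spectrum.zero_notMem_iff ℂ, spectrum.map_polynomial_aeval_of_nonempty S _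
      (spectrum.nonempty_of_isAlgClosed_of_finiteDimensional ℂ S)]
    rintro ⟨μ, hμ, hr⟩
    have h1 : μ ∈ spectrum ℂ (-T) := Matrix.mem_spectrum_iff_isRoot_charpoly.2 hr
    rw [← spectrum.neg_eq, Set.mem_neg] at h1
    have h2 := hT.2 _ h1
    have h3 := hS.2 _ hμ
    rw [Complex.neg_re] at h2
    linarith
  exact sub_eq_zero.1 (hu.mul_right_eq_zero.1 h0)

theorem IsPrincipalSqrt.eq_principalSqrt {n : ℕ} {S M : Matrix (Fin n) (Fin n) ℂ}
    (hS : IsPrincipalSqrt S M) : principalSqrt M = S := by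
  have h : ∃ S, IsPrincipalSqrt S M := ⟨S, hS⟩
  rw [principalSqrt, dif_pos h]
  exact h.choose_spec.unique hS

theorem isPrincipalSqrt_principalSqrt_mul {n : ℕ} {A B : Matrix (Fin n) (Fin n) ℂ}
    (hA : A.PosDef) (hB : B.PosDef) : IsPrincipalSqrt (principalSqrt (A * B)) (A * B) := by
  have hRR : CFC.sqrt A * CFC.sqrt A = A := CFC.sqrt_mul_sqrt_self A hA.posSemidef.nonneg
  have hRu : IsUnit (CFC.sqrt A) := by
    have h := hA.isUnit
    rw [← hRR] at h
    exact isUnit_of_mul_isUnit_left h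
  have hRd : IsUnit (CFC.sqrt A).det := (Matrix.isUnit_iff_isUnit_det _).1 hRu
  have hRH : (CFC.sqrt A).IsHermitian := (Matrix.nonneg_iff_posSemidef.1 (CFC.sqrt_nonneg A)).isHermitian
  have hC : (CFC.sqrt A * B * CFC.sqrt A).PosSemidef := by
    have h := hB.posSemidef.mul_mul_conjTranspose_same (CFC.sqrt A)
    rwa [hRH.eq] at h
  set R := CFC.sqrt A
  set P := CFC.sqrt (R * B * R)
  have hPP : P * P = R * B * R := CFC.sqrt_mul_sqrt_self _ hC.nonneg
  have hP0 : P.PosSemidef := Matrix.nonneg_iff_posSemidef.1 (CFC.sqrt_nonneg _)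
  have hP : P.PosDef := by
    refine hP0.posDef_iff_isUnit.2 ?_
    have h : IsUnit (P * P) := by
      rw [hPP]
      exact (hRu.mul hB.isUnit).mul hRu
    exact isUnit_of_mul_isUnit_left h
  have hS : IsPrincipalSqrt (R * P * R⁻¹) (A * B) := by
    refine ⟨?_, fun μ hμ => ?_⟩
    · calc R * P * R⁻¹ * (R * P * R⁻¹) = R * P * (R⁻¹ * R) * P * R⁻¹ := by
            simp only [mul_assoc]
        _ = R * (P * P) * R⁻¹ := by
            rw [Matrix.nonsing_inv_mul R hRd, mul_one]
            simp only [mul_assoc]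
        _ = R * R * B * (R * R⁻¹) := by
            rw [hPP]
            simp only [mul_assoc]
        _ = A * B := by rw [Matrix.mul_nonsing_inv R hRd, mul_one, hRR]
    · have hu : R * P * R⁻¹ = (hRu.unit : Matrix (Fin n) (Fin n) ℂ) * P *
          ((hRu.unit⁻¹ : (Matrix (Fin n) (Fin n) ℂ)ˣ) : Matrix (Fin n) (Fin n) ℂ) := by
        rw [Matrix.coe_units_inv, IsUnit.unit_spec]
      rw [hu, spectrum.units_conjugate, hP.isHermitian.spectrum_eq_image_range] at hμ
      obtain ⟨_, ⟨i, rfl⟩, rfl⟩ := hμ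
      simpa using hP.eigenvalues_pos i
  rw [hS.eq_principalSqrt]
  exact hS

theorem principalSqrt_mul_conjTranspose {n : ℕ} {A B : Matrix (Fin n) (Fin n) ℂ}
    (hA : A.PosDef) (hB : B.PosDef) :
    (principalSqrt (A * B)).conjTranspose = principalSqrt (B * A) := by
  have h := isPrincipalSqrt_principalSqrt_mul hA hB
  refine (IsPrincipalSqrt.eq_principalSqrt ⟨?_, fun μ hμ => ?_⟩).symm
  · rw [← Matrix.conjTranspose_mul, h.1, Matrix.conjTranspose_mul, hA.isHermitian.eq,
      hB.isHermitian.eq]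
  · rw [← Matrix.star_eq_conjTranspose, spectrum.map_star, Set.mem_star] at hμ
    simpa using h.2 _ hμ

theorem isHermitian_wasserstein {n : ℕ} {A B : Matrix (Fin n) (Fin n) ℂ}
    (hA : A.PosDef) (hB : B.PosDef) (a b : ℝ) : (wasserstein a b A B).IsHermitian := by
  simp only [Matrix.IsHermitian, wasserstein, Matrix.conjTranspose_add,
    Matrix.conjTranspose_smul, star_trivial, hA.isHermitian.eq, hB.isHermitian.eq,
    principalSqrt_mul_conjTranspose hA hB, principalSqrt_mul_conjTranspose hB hA]
  rw [add_comm (principalSqrt (B * A))]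

theorem isHermitian_heron {n : ℕ} {A B : Matrix (Fin n) (Fin n) ℂ}
    (hA : A.PosDef) (hB : B.PosDef) (a b : ℝ) : (heron a b A B).IsHermitian := by
  have h (X : Matrix (Fin n) (Fin n) ℂ) : (CFC.sqrt X).conjTranspose = CFC.sqrt X :=
    (Matrix.nonneg_iff_posSemidef.1 (CFC.sqrt_nonneg X)).isHermitian.eq
  simp only [Matrix.IsHermitian, heron, geomMean, Matrix.conjTranspose_add,
    Matrix.conjTranspose_smul, star_trivial, hA.isHermitian.eq, hB.isHermitian.eq,
    Matrix.conjTranspose_mul, h, mul_assoc]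

end

end HeronMeans

namespace HeronMeans

section

/-! The positive definite solution `X` of the Riccati equation `X * A * X = B` gives `(AB)^{1/2} = A
* X`, so the Wasserstein expression is the congruence `M * A * M` with `M = a + b X`. Put `K = M⁻¹`.
A bound `M * A * M ≤ c` says `A ≤ c K²`, hence `B = X * A * X ≤ c X K² X`. The geometric mean of
these two bounds is `c K X K`, because `K` and `X` commute, and monotonicity gives `A # B ≤ c K X
K`. Since `a² K² + b² X K² X + 2ab K X K = K M² K = 1`, adding up bounds the Heron expression by `c`
(`heron_le_smul_one`). Reversing every inequality gives the lower bound (`smul_one_le_heron`), and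
taking `c` to be an extreme eigenvalue settles the first two claims. The trace inequality is a
completed square (`trace_geomMean_le`). The sum of the `n - 1` largest eigenvalues is the trace
minus the smallest one, so the last claim follows from the other two. -/

open scoped Matrix.Norms.L2Operator in
theorem le_of_mul_self_le_mul_self {n : ℕ} {S T : Matrix (Fin n) (Fin n) ℂ}
    (hS : 0 ≤ S) (hT : 0 ≤ T) (h : S * S ≤ T * T) : S ≤ T := by
  have := CFC.sqrt_le_sqrt _ _ h
  rwa [CFC.sqrt_mul_self S hS, CFC.sqrt_mul_self T hT] at this

/-! ### Congruence and square roots in the Loewner order -/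

variable {n : ℕ} {A B G X K M R g : Matrix (Fin n) (Fin n) ℂ}

theorem conj_le_conj (hR : R.IsHermitian) (h : A ≤ B) : R * A * R ≤ R * B * R :=
  IsSelfAdjoint.conjugate_le_conjugate h hR

theorem le_of_conj_le_conj {R' : Matrix (Fin n) (Fin n) ℂ} (hR' : R'.IsHermitian)
    (h1 : R * R' = 1) (h2 : R' * R = 1) (h : R * A * R ≤ R * B * R) : A ≤ B := by
  have := conj_le_conj hR' h
  have e (C : Matrix (Fin n) (Fin n) ℂ) : R' * (R * C * R) * R' = C := by
    rw [show R' * (R * C * R) * R' = (R' * R) * C * (R * R') by simp only [mul_assoc], h1, h2,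
      one_mul, mul_one]
  rwa [e, e] at this

/-- A form of operator monotonicity of the square root, relative to the weight `R * R`. -/
theorem le_of_weighted_sq_le {R' : Matrix (Fin n) (Fin n) ℂ} (hR : R.IsHermitian)
    (hR' : R'.IsHermitian) (h1 : R * R' = 1) (h2 : R' * R = 1) (hG : 0 ≤ G) (hg : 0 ≤ g)
    (h : G * (R * R) * G ≤ g * (R * R) * g) : G ≤ g := by
  -- Congruence by `R` turns the hypothesis into `(R G R)² ≤ (R g R)²`, to which monotonicity of the
  -- square root applies.
  refine le_of_conj_le_conj hR' h1 h2 (le_of_mul_self_le_mul_self ?_ ?_ ?_)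
  · simpa using conj_le_conj hR hG
  · simpa using conj_le_conj hR hg
  · simpa only [mul_assoc] using conj_le_conj hR h

/-- Square roots of a positive definite matrix and of its inverse. -/
theorem exists_sqrt_pair (hA : A.PosDef) : ∃ R R' : Matrix (Fin n) (Fin n) ℂ,
    R = CFC.sqrt A ∧ R' = R⁻¹ ∧ R.PosDef ∧ R'.PosDef ∧ R * R = A ∧ R' * R' = A⁻¹ ∧
      R * R' = 1 ∧ R' * R = 1 := by
  have hRR : CFC.sqrt A * CFC.sqrt A = A := CFC.sqrt_mul_sqrt_self A hA.posSemidef.nonneg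
  have hRu : IsUnit (CFC.sqrt A) := by
    have h := hA.isUnit
    rw [← hRR] at h
    exact isUnit_of_mul_isUnit_left h
  have hRd : IsUnit (CFC.sqrt A).det := (Matrix.isUnit_iff_isUnit_det _).1 hRu
  have hP : (CFC.sqrt A).PosDef :=
    (Matrix.nonneg_iff_posSemidef.1 (CFC.sqrt_nonneg A)).posDef_iff_isUnit.2 hRu
  refine ⟨_, _, rfl, rfl, hP, hP.inv, hRR, ?_, Matrix.mul_nonsing_inv _ hRd,
    Matrix.nonsing_inv_mul _ hRd⟩
  rw [← Matrix.mul_inv_rev, hRR]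

theorem PosDef.conj (hB : B.PosDef) (hR : R.PosDef) : (R * B * R).PosDef := by
  refine Matrix.PosSemidef.posDef_iff_isUnit ?_ |>.2 ((hR.isUnit.mul hB.isUnit).mul hR.isUnit)
  have h := hB.posSemidef.mul_mul_conjTranspose_same R
  rwa [hR.isHermitian.eq] at h

/-! ### The geometric mean, the Riccati equation and the factorization of W -/

theorem posDef_geomMean (hA : A.PosDef) (hB : B.PosDef) : (geomMean A B).PosDef := by
  obtain ⟨R, R', hR, hR', pR, pR', -⟩ := exists_sqrt_pair hA
  obtain ⟨P, -, hP, -, pP, -⟩ := exists_sqrt_pair (PosDef.conj hB pR')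
  rw [geomMean, ← hR, ← hR', ← hP]
  exact PosDef.conj pP pR

/-- The only property of the geometric mean used below, besides positivity: the inner factors
`A^{1/2}` cancel against `A⁻¹`, leaving the square of the middle root. -/
theorem geomMean_mul_inv_mul_geomMean (hA : A.PosDef) (hB : B.PosDef) :
    geomMean A B * A⁻¹ * geomMean A B = B := by
  obtain ⟨R, R', hR, hR', pR, pR', -, h', h1, h2⟩ := exists_sqrt_pair hA
  obtain ⟨P, -, hP, -, -, -, hPP, -⟩ := exists_sqrt_pair (PosDef.conj hB pR')
  rw [geomMean, ← hR, ← hR', ← hP, ← h']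
  calc R * P * R * (R' * R') * (R * P * R) = R * P * (R * R') * (R' * R) * P * R := by
        simp only [mul_assoc]
    _ = R * (P * P) * R := by rw [h1, h2]; simp only [mul_assoc, one_mul]
    _ = (R * R') * B * (R' * R) := by rw [hPP]; simp only [mul_assoc]
    _ = B := by rw [h1, h2, one_mul, mul_one]

theorem re_pos_of_mem_spectrum_mul (hA : A.PosDef) (hX : X.PosDef) :
    ∀ μ ∈ spectrum ℂ (A * X), 0 < μ.re := by
  intro μ hμ
  obtain ⟨R, R', -, hR', pR, pR', hRR, -, h1, h2⟩ := exists_sqrt_pair hA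
  have hP := PosDef.conj hX pR
  have hu : A * X = (pR.isUnit.unit : Matrix (Fin n) (Fin n) ℂ) * (R * X * R) *
      ((pR.isUnit.unit⁻¹ : (Matrix (Fin n) (Fin n) ℂ)ˣ) : Matrix (Fin n) (Fin n) ℂ) := by
    rw [Matrix.coe_units_inv, IsUnit.unit_spec, ← hR',
      show R * (R * X * R) * R' = R * R * X * (R * R') by simp only [mul_assoc], h1, mul_one, hRR]
  rw [hu, spectrum.units_conjugate, hP.isHermitian.spectrum_eq_image_range] at hμ
  obtain ⟨_, ⟨i, rfl⟩, rfl⟩ := hμ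
  simpa using hP.eigenvalues_pos i

theorem principalSqrt_mul_eq (hA : A.PosDef) (hX : X.PosDef) (h : X * A * X = B) :
    principalSqrt (A * B) = A * X :=
  IsPrincipalSqrt.eq_principalSqrt
    ⟨by rw [← h]; simp only [mul_assoc], re_pos_of_mem_spectrum_mul hA hX⟩

theorem principalSqrt_mul_eq' (hA : A.PosDef) (hX : X.PosDef) (h : X * A * X = B) :
    principalSqrt (B * A) = X * A :=
  IsPrincipalSqrt.eq_principalSqrt
    ⟨by rw [← h]; simp only [mul_assoc], re_pos_of_mem_spectrum_mul hX hA⟩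

theorem wasserstein_eq (hA : A.PosDef) (hX : X.PosDef) (h : X * A * X = B) (a b : ℝ) :
    wasserstein a b A B = (a • 1 + b • X) * A * (a • 1 + b • X) := by
  rw [wasserstein, principalSqrt_mul_eq hA hX h, principalSqrt_mul_eq' hA hX h, ← h]
  simp only [add_mul, mul_add, smul_mul_assoc, mul_smul_comm, smul_smul, smul_add, one_mul,
    mul_one, pow_two, mul_comm b a]
  abel

theorem exists_riccati (hA : A.PosDef) (hB : B.PosDef) :
    ∃ X : Matrix (Fin n) (Fin n) ℂ, X.PosDef ∧ X * A * X = B := by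
  -- The solution is `A⁻¹ # B`.
  refine ⟨_, posDef_geomMean hA.inv hB, ?_⟩
  have h := geomMean_mul_inv_mul_geomMean hA.inv hB
  rwa [Matrix.nonsing_inv_nonsing_inv _ ((Matrix.isUnit_iff_isUnit_det _).1 hA.isUnit)] at h

/-! ### Inversion and the algebra of `M = a + b X` -/

theorem le_smul_inv {c : ℝ} (hA : A.PosDef) (h : A ≤ c • 1) : 1 ≤ c • A⁻¹ := by
  obtain ⟨R, R', -, -, pR, pR', hRR, hRR', h1, h2⟩ := exists_sqrt_pair hA
  have := conj_le_conj pR'.isHermitian h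
  rwa [← hRR, show R' * (R * R) * R' = (R' * R) * (R * R') by simp only [mul_assoc], h1, h2,
    mul_smul_comm, smul_mul_assoc, mul_one, mul_one, hRR'] at this

theorem smul_inv_le {c : ℝ} (hA : A.PosDef) (h : c • 1 ≤ A) : c • A⁻¹ ≤ 1 := by
  obtain ⟨R, R', -, -, pR, pR', hRR, hRR', h1, h2⟩ := exists_sqrt_pair hA
  have := conj_le_conj pR'.isHermitian h
  rwa [← hRR, show R' * (R * R) * R' = (R' * R) * (R * R') by simp only [mul_assoc], h1, h2,
    mul_smul_comm, smul_mul_assoc, mul_one, mul_one, hRR'] at this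

theorem smul_le_smul_of_le {c : ℝ} (hc : 0 ≤ c) (h : A ≤ B) : c • A ≤ c • B := by
  rw [Matrix.le_iff, ← smul_sub]
  exact (Matrix.le_iff.1 h).smul hc

theorem inv_conj (h1 : M * K = 1) : (M * A * M)⁻¹ = K * A⁻¹ * K := by
  rw [Matrix.mul_inv_rev, Matrix.mul_inv_rev, Matrix.inv_eq_right_inv h1, mul_assoc]

/-- With `M * M` the inverse of `K * K`, this is the Riccati equation identifying `K X K` as the
geometric mean of `K²` and `X K² X`. -/
theorem conj_mul_mul_conj (h1 : M * K = 1) (h2 : K * M = 1) (hKX : K * X = X * K) :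
    K * X * K * (M * M) * (K * X * K) = X * (K * K) * X := by
  calc K * X * K * (M * M) * (K * X * K) = K * X * (K * M) * (M * K) * X * K := by
        simp only [mul_assoc]
    _ = (K * X) * (X * K) := by rw [h1, h2, mul_one, mul_one, mul_assoc]
    _ = X * (K * K) * X := by
        rw [← hKX]
        nth_rewrite 1 [hKX]
        simp only [mul_assoc]

theorem posDef_smul_one_add_smul {a b : ℝ} (ha : 0 ≤ a) (hb : 0 ≤ b) (hab : 0 < a ∨ 0 < b)
    (hX : X.PosDef) : (a • 1 + b • X).PosDef := by
  rcases hab with h | h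
  · exact (Matrix.PosDef.one.smul h).add_posSemidef (hX.posSemidef.smul hb)
  · exact Matrix.PosDef.posSemidef_add (Matrix.PosSemidef.one.smul ha) (hX.smul h)

/-- Everything that depends on `M = a + b X`: its inverse `K`, and a resolution of the identity. -/
theorem exists_inverse {a b : ℝ} (ha : 0 ≤ a) (hb : 0 ≤ b) (hab : 0 < a ∨ 0 < b)
    (hX : X.PosDef) : ∃ M K : Matrix (Fin n) (Fin n) ℂ, M = a • 1 + b • X ∧ M.PosDef ∧
      K.PosDef ∧ M * K = 1 ∧ K * M = 1 ∧ K * X = X * K ∧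
      a ^ 2 • (K * K) + b ^ 2 • (X * (K * K) * X) + (2 * a * b) • (K * X * K) = 1 := by
  have hM := posDef_smul_one_add_smul ha hb hab hX
  set M : Matrix (Fin n) (Fin n) ℂ := a • 1 + b • X with hMdef
  have hd : IsUnit M.det := (Matrix.isUnit_iff_isUnit_det _).1 hM.isUnit
  have h1 : M * M⁻¹ = 1 := Matrix.mul_nonsing_inv _ hd
  have h2 : M⁻¹ * M = 1 := Matrix.nonsing_inv_mul _ hd
  have hMX : M * X = X * M := by
    simp only [hMdef, add_mul, mul_add, smul_mul_assoc, mul_smul_comm, one_mul, mul_one]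
  have hKX : M⁻¹ * X = X * M⁻¹ := by
    calc M⁻¹ * X = M⁻¹ * (X * M) * M⁻¹ := by rw [mul_assoc, mul_assoc, h1, mul_one]
      _ = X * M⁻¹ := by rw [← hMX, ← mul_assoc, h2, one_mul]
  refine ⟨M, M⁻¹, rfl, hM, hM.inv, h1, h2, hKX, ?_⟩
  have hKMMK : M⁻¹ * (M * M) * M⁻¹ = 1 := by
    rw [← mul_assoc, h2, one_mul, h1]
  have e : X * (M⁻¹ * M⁻¹) * X = M⁻¹ * (X * X) * M⁻¹ := by
    rw [← mul_assoc, ← hKX]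
    simp only [mul_assoc]
    rw [hKX]
  have hMM : M * M = a ^ 2 • 1 + b ^ 2 • (X * X) + (2 * a * b) • X := by
    simp only [hMdef, add_mul, mul_add, smul_mul_assoc, mul_smul_comm, smul_smul, smul_add,
      one_mul, mul_one, pow_two, mul_comm b a]
    rw [show 2 * a * b = a * b + a * b by ring, add_smul]
    abel
  rw [e, ← hKMMK, hMM]
  simp only [add_mul, mul_add, smul_mul_assoc, mul_smul_comm, mul_one]

/-! ### Scalar bounds pass from W to the Heron expression -/

theorem heron_le_smul_one {a b c : ℝ} (ha : 0 ≤ a) (hb : 0 ≤ b) (hab : 0 < a ∨ 0 < b)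
    (hc : 0 ≤ c) (hA : A.PosDef) (hB : B.PosDef) (h : wasserstein a b A B ≤ c • 1) :
    heron a b A B ≤ c • 1 := by
  obtain ⟨X, hX, hXAX⟩ := exists_riccati hA hB
  obtain ⟨M, K, hM, pM, pK, h1, h2, hKX, hid⟩ := exists_inverse ha hb hab hX
  rw [wasserstein_eq hA hX hXAX, ← hM] at h
  have hinv := le_smul_inv (PosDef.conj hA pM) h
  rw [inv_conj h1] at hinv
  have hAK : A ≤ c • (K * K) := by
    refine le_of_conj_le_conj pK.isHermitian h1 h2 (h.trans_eq ?_)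
    rw [mul_smul_comm, smul_mul_assoc, ← mul_assoc, h1, one_mul, h2]
  have hBK : B ≤ c • (X * (K * K) * X) := by
    have := conj_le_conj hX.isHermitian hAK
    rwa [hXAX, mul_smul_comm, smul_mul_assoc] at this
  have hMA : M * M ≤ c • A⁻¹ := by
    refine le_of_conj_le_conj pM.isHermitian h2 h1 (le_trans (le_of_eq ?_) (hinv.trans_eq ?_))
    · rw [← mul_assoc, h2, one_mul, h1]
    · rw [mul_smul_comm, smul_mul_assoc]
  -- Monotonicity of the geometric mean, obtained by comparing two Riccati equations with the common
  -- weight `M²`.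
  have hG : geomMean A B ≤ c • (K * X * K) := by
    have pG := posDef_geomMean hA hB
    refine le_of_weighted_sq_le pM.isHermitian pK.isHermitian h1 h2 pG.posSemidef.nonneg
      (((PosDef.conj hX pK).posSemidef.smul hc).nonneg) ?_
    calc geomMean A B * (M * M) * geomMean A B
        ≤ geomMean A B * (c • A⁻¹) * geomMean A B := conj_le_conj pG.isHermitian hMA
      _ = c • B := by
        rw [mul_smul_comm, smul_mul_assoc, geomMean_mul_inv_mul_geomMean hA hB]
      _ ≤ c • c • (X * (K * K) * X) := smul_le_smul_of_le hc hBK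
      _ = (c • (K * X * K)) * (M * M) * (c • (K * X * K)) := by
        simp only [smul_mul_assoc, mul_smul_comm, conj_mul_mul_conj h1 h2 hKX]
  have := add_le_add (add_le_add (smul_le_smul_of_le (sq_nonneg a) hAK)
    (smul_le_smul_of_le (sq_nonneg b) hBK))
    (smul_le_smul_of_le (by positivity : 0 ≤ 2 * a * b) hG)
  rw [heron]
  refine this.trans_eq ?_
  rw [smul_comm _ c, smul_comm _ c, smul_comm _ c, ← smul_add, ← smul_add, hid]

theorem smul_one_le_heron {a b c : ℝ} (ha : 0 ≤ a) (hb : 0 ≤ b) (hab : 0 < a ∨ 0 < b)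
    (hc : 0 ≤ c) (hA : A.PosDef) (hB : B.PosDef) (h : c • 1 ≤ wasserstein a b A B) :
    c • 1 ≤ heron a b A B := by
  obtain ⟨X, hX, hXAX⟩ := exists_riccati hA hB
  obtain ⟨M, K, hM, pM, pK, h1, h2, hKX, hid⟩ := exists_inverse ha hb hab hX
  rw [wasserstein_eq hA hX hXAX, ← hM] at h
  have hinv := smul_inv_le (PosDef.conj hA pM) h
  rw [inv_conj h1] at hinv
  have hAK : c • (K * K) ≤ A := by
    refine le_of_conj_le_conj pK.isHermitian h1 h2 (le_trans (le_of_eq ?_) h)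
    rw [mul_smul_comm, smul_mul_assoc, ← mul_assoc, h1, one_mul, h2]
  have hBK : c • (X * (K * K) * X) ≤ B := by
    have := conj_le_conj hX.isHermitian hAK
    rwa [hXAX, mul_smul_comm, smul_mul_assoc] at this
  have hMA : c • A⁻¹ ≤ M * M := by
    refine le_of_conj_le_conj pM.isHermitian h2 h1 (le_trans (le_of_eq ?_) (hinv.trans_eq ?_))
    · rw [mul_smul_comm, smul_mul_assoc]
    · rw [← mul_assoc, h2, one_mul, h1]
  have hG : c • (K * X * K) ≤ geomMean A B := by
    have pG := posDef_geomMean hA hB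
    have pKXK := PosDef.conj hX pK
    obtain ⟨R, R', -, -, pR, pR', hRR, hRR', h3, h4⟩ := exists_sqrt_pair hA
    -- Here the common weight is `A⁻¹ = R' * R'`.
    refine le_of_weighted_sq_le pR'.isHermitian pR.isHermitian h4 h3
      ((pKXK.posSemidef.smul hc).nonneg) pG.posSemidef.nonneg ?_
    rw [hRR', geomMean_mul_inv_mul_geomMean hA hB]
    calc (c • (K * X * K)) * A⁻¹ * (c • (K * X * K))
        = c • ((K * X * K) * (c • A⁻¹) * (K * X * K)) := by
          simp only [smul_mul_assoc, mul_smul_comm]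
      _ ≤ c • ((K * X * K) * (M * M) * (K * X * K)) :=
          smul_le_smul_of_le hc (conj_le_conj pKXK.isHermitian hMA)
      _ = c • (X * (K * K) * X) := by
        rw [conj_mul_mul_conj h1 h2 hKX]
      _ ≤ B := hBK
  have := add_le_add (add_le_add (smul_le_smul_of_le (sq_nonneg a) hAK)
    (smul_le_smul_of_le (sq_nonneg b) hBK))
    (smul_le_smul_of_le (by positivity : 0 ≤ 2 * a * b) hG)
  rw [heron]
  refine le_trans (le_of_eq ?_) this
  rw [smul_comm _ c, smul_comm _ c, smul_comm _ c, ← smul_add, ← smul_add, hid]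

/-! ### The trace inequality -/

theorem trace_geomMean_le (hA : A.PosDef) (hX : X.PosDef) (h : X * A * X = B) :
    (geomMean A B).trace.re ≤ (A * X).trace.re := by
  have hB : B.PosDef := h ▸ PosDef.conj hA hX
  have hG := geomMean_mul_inv_mul_geomMean hA hB
  have pG := posDef_geomMean hA hB
  set G := geomMean A B
  obtain ⟨R, R', -, -, pR, pR', hRR, hRR', h1, h2⟩ := exists_sqrt_pair hA
  obtain ⟨Y, Z, -, -, pY, pZ, hYY, -, h3, h4⟩ := exists_sqrt_pair hX
  -- The trace of this square is `2 Tr(AX) - 2 Tr G`: both diagonal terms have trace `Tr(AX)`, and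
  -- in both cross terms `X^{1/2}` cancels `X^{-1/2}`.
  have key := (Matrix.posSemidef_conjTranspose_mul_self (R * Y - R' * G * Z)).trace_nonneg
  have e : (R * Y - R' * G * Z).conjTranspose * (R * Y - R' * G * Z) =
      Y * A * Y - Y * G * Z - Z * G * Y + Z * B * Z := by
    simp only [Matrix.conjTranspose_sub, Matrix.conjTranspose_mul, pR.isHermitian.eq,
      pR'.isHermitian.eq, pY.isHermitian.eq, pZ.isHermitian.eq, pG.isHermitian.eq]
    calc _ = Y * (R * R) * Y - Y * (R * R') * G * Z - Z * G * (R' * R) * Y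
        + Z * (G * (R' * R') * G) * Z := by noncomm_ring
      _ = _ := by rw [hRR, hRR', h1, h2, hG, mul_one, mul_one]
  have t1 : (Y * A * Y).trace = (A * X).trace := by
    rw [mul_assoc, Matrix.trace_mul_comm, mul_assoc, hYY]
  have t2 : (Y * G * Z).trace = G.trace := by
    rw [Matrix.trace_mul_comm, ← mul_assoc, h4, one_mul]
  have t3 : (Z * G * Y).trace = G.trace := by
    rw [Matrix.trace_mul_comm, ← mul_assoc, h3, one_mul]
  have t4 : (Z * B * Z).trace = (A * X).trace := by
    rw [← h, ← hYY, show Z * (Y * Y * A * (Y * Y)) * Z = (Z * Y) * (Y * A * Y) * (Y * Z) by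
      simp only [mul_assoc], h3, h4, one_mul, mul_one, t1, hYY]
  rw [e, Matrix.trace_add, Matrix.trace_sub, Matrix.trace_sub, t1, t2, t3, t4] at key
  have := (Complex.le_def.1 key).1
  simp only [Complex.zero_re, Complex.add_re, Complex.sub_re] at this
  linarith

theorem trace_heron_le {a b : ℝ} (ha : 0 ≤ a) (hb : 0 ≤ b) (hA : A.PosDef) (hB : B.PosDef) :
    (heron a b A B).trace.re ≤ (wasserstein a b A B).trace.re := by
  obtain ⟨X, hX, hXAX⟩ := exists_riccati hA hB
  have h := mul_le_mul_of_nonneg_left (trace_geomMean_le hA hX hXAX) (mul_nonneg ha hb)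
  rw [heron, wasserstein, principalSqrt_mul_eq hA hX hXAX, principalSqrt_mul_eq' hA hX hXAX]
  simp only [Matrix.trace_add, Matrix.trace_smul, Matrix.trace_mul_comm X A, Complex.add_re,
    Complex.smul_re, smul_eq_mul]
  linarith

/-! ### Ordered eigenvalues and scalar bounds -/

variable {T : Matrix (Fin n) (Fin n) ℂ}

theorem eigDesc_antitone (hT : T.IsHermitian) : Antitone (eigDesc T hT) :=
  fun _ _ h => hT.eigenvalues₀_antitone h

theorem spectrum_eq_range_eigDesc (hT : T.IsHermitian) :
    spectrum ℝ T = Set.range (eigDesc T hT) := by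
  rw [hT.spectrum_real_eq_range_eigenvalues]
  ext x
  constructor
  · rintro ⟨i, rfl⟩
    exact ⟨Fin.cast (Fintype.card_fin n) ((Fintype.equivOfCardEq (Fintype.card_fin _)).symm i), rfl⟩
  · rintro ⟨i, rfl⟩
    exact ⟨Fintype.equivOfCardEq (Fintype.card_fin _) (Fin.cast (Fintype.card_fin n).symm i),
      by simp [Matrix.IsHermitian.eigenvalues, eigDesc]⟩

theorem sum_eigDesc (hT : T.IsHermitian) : ∑ j, eigDesc T hT j = T.trace.re := by
  rw [hT.trace_eq_sum_eigenvalues]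
  simp only [Complex.re_sum, Complex.coe_algebraMap, Complex.ofReal_re]
  exact (Equiv.sum_comp (finCongr (Fintype.card_fin n).symm) hT.eigenvalues₀).trans
    (Equiv.sum_comp (Fintype.equivOfCardEq (Fintype.card_fin _)).symm hT.eigenvalues₀).symm

theorem smul_one_le_iff_eigDesc (hl : n - 1 < n) (hT : T.IsHermitian) (c : ℝ) :
    c • 1 ≤ T ↔ c ≤ eigDesc T hT ⟨n - 1, hl⟩ := by
  rw [← Algebra.algebraMap_eq_smul_one, algebraMap_le_iff_le_spectrum (ha := hT),
    spectrum_eq_range_eigDesc hT, Set.forall_mem_range]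
  exact ⟨fun h => h _, fun h i => h.trans (eigDesc_antitone hT (Fin.mk_le_mk.2 (by omega)))⟩

theorem le_smul_one_iff_eigDesc (h0n : 0 < n) (hT : T.IsHermitian) (c : ℝ) :
    T ≤ c • 1 ↔ eigDesc T hT ⟨0, h0n⟩ ≤ c := by
  rw [← Algebra.algebraMap_eq_smul_one, le_algebraMap_iff_spectrum_le (ha := hT),
    spectrum_eq_range_eigDesc hT, Set.forall_mem_range]
  exact ⟨fun h => h _, fun h i => le_trans (eigDesc_antitone hT (Nat.zero_le _)) h⟩

theorem sum_eigDesc_lt (hl : n - 1 < n) (hT : T.IsHermitian) :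
    ∑ j : Fin n with j.val < n - 1, eigDesc T hT j =
      T.trace.re - eigDesc T hT ⟨n - 1, hl⟩ := by
  rw [← sum_eigDesc hT, ← Finset.sum_erase_eq_sub (Finset.mem_univ _)]
  refine Finset.sum_congr (Finset.ext fun j => ?_) fun _ _ => rfl
  simp only [Finset.mem_filter, Finset.mem_univ, true_and, Finset.mem_erase, and_true, ne_eq,
    Fin.ext_iff]
  omega

theorem wasserstein_nonneg (hA : A.PosDef) (hB : B.PosDef) (a b : ℝ) :
    0 ≤ wasserstein a b A B := by
  obtain ⟨X, hX, hXAX⟩ := exists_riccati hA hB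
  have hM : (a • 1 + b • X).IsHermitian := by
    simp [Matrix.IsHermitian, hX.isHermitian.eq]
  rw [wasserstein_eq hA hX hXAX]
  simpa using conj_le_conj hM hA.posSemidef.nonneg

theorem eigDesc_last_le_and_eigDesc_zero_le (hl : n - 1 < n) (h0n : 0 < n) {a b : ℝ}
    (ha : 0 ≤ a) (hb : 0 ≤ b) (hA : A.PosDef) (hB : B.PosDef) :
    eigDesc _ (isHermitian_wasserstein hA hB a b) ⟨n - 1, hl⟩ ≤
        eigDesc _ (isHermitian_heron hA hB a b) ⟨n - 1, hl⟩ ∧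
      eigDesc _ (isHermitian_heron hA hB a b) ⟨0, h0n⟩ ≤
        eigDesc _ (isHermitian_wasserstein hA hB a b) ⟨0, h0n⟩ := by
  have hW := isHermitian_wasserstein hA hB a b
  -- The transfer of scalar bounds needs `0 ≤ c`, which holds because W is positive semidefinite.
  have h0 : 0 ≤ eigDesc _ hW ⟨n - 1, hl⟩ := by
    rw [← smul_one_le_iff_eigDesc hl, zero_smul]
    exact wasserstein_nonneg hA hB a b
  have h0' : 0 ≤ eigDesc _ hW ⟨0, h0n⟩ :=
    h0.trans (eigDesc_antitone hW (Fin.mk_le_mk.2 (Nat.zero_le _)))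
  have hmin := (smul_one_le_iff_eigDesc hl hW _).2 le_rfl
  have hmax := (le_smul_one_iff_eigDesc h0n hW _).2 le_rfl
  rw [← smul_one_le_iff_eigDesc hl, ← le_smul_one_iff_eigDesc h0n]
  by_cases hab : 0 < a ∨ 0 < b
  · exact ⟨smul_one_le_heron ha hb hab h0 hA hB hmin, heron_le_smul_one ha hb hab h0' hA hB hmax⟩
  -- In this case `M = 0` has no inverse, but both expressions vanish.
  · obtain ⟨rfl, rfl⟩ : a = 0 ∧ b = 0 := by
      push Not at hab
      exact ⟨le_antisymm hab.1 ha, le_antisymm hab.2 hb⟩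
    have e : heron 0 0 A B = wasserstein 0 0 A B := by simp [heron, wasserstein]
    rw [e]
    exact ⟨hmin, hmax⟩

end

end HeronMeans

theorem mainTheorem8 (n : ℕ) (hn : 1 ≤ n) (A B : Matrix (Fin n) (Fin n) ℂ)
    (hA : A.PosDef) (hB : B.PosDef) (a b : ℝ) (ha : 0 ≤ a) (hb : 0 ≤ b) :
    -- smallest eigenvalue
    HeronMeans.eigDesc (HeronMeans.wasserstein a b A B)
          (HeronMeans.isHermitian_wasserstein hA hB a b) ⟨n - 1, by omega⟩ ≤
      HeronMeans.eigDesc (HeronMeans.heron a b A B)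
          (HeronMeans.isHermitian_heron hA hB a b) ⟨n - 1, by omega⟩ ∧
    -- largest eigenvalue
    HeronMeans.eigDesc (HeronMeans.heron a b A B)
          (HeronMeans.isHermitian_heron hA hB a b) ⟨0, by omega⟩ ≤
      HeronMeans.eigDesc (HeronMeans.wasserstein a b A B)
          (HeronMeans.isHermitian_wasserstein hA hB a b) ⟨0, by omega⟩ ∧
    -- trace (the traces are real, since both matrices are Hermitian)
    (HeronMeans.heron a b A B).trace.re ≤ (HeronMeans.wasserstein a b A B).trace.re ∧
    -- sum of the `n - 1` largest eigenvalues
    ∑ j : Fin n with j.val < n - 1,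
        HeronMeans.eigDesc (HeronMeans.heron a b A B)
          (HeronMeans.isHermitian_heron hA hB a b) j ≤
      ∑ j : Fin n with j.val < n - 1,
        HeronMeans.eigDesc (HeronMeans.wasserstein a b A B)
          (HeronMeans.isHermitian_wasserstein hA hB a b) j := by
  have hl : n - 1 < n := Nat.sub_lt hn one_pos
  have h := HeronMeans.eigDesc_last_le_and_eigDesc_zero_le hl hn ha hb hA hB
  have ht := HeronMeans.trace_heron_le ha hb hA hB
  refine ⟨h.1, h.2, ht, ?_⟩
  rw [HeronMeans.sum_eigDesc_lt hl, HeronMeans.sum_eigDesc_lt hl]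
  linarith [h.1]
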